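/- Let $\mathcal C$ and $\mathcal D$ be rigidly-compactly generated tensor-triangulated categories, i.e. triangulated categories with a compatible closed symmetric monoidal structure $(\otimes,\mathbb 1,\underline{\mathrm{hom}})$, with arbitrary small coproducts, generated by a set of compact objects (an object $t$ is zero as soon as every map to $t$ from a member of that set is zero), and in which the compact objects are exactly the rigid ones ($x$ is rigid if $\underline{\mathrm{hom}}(x,\mathbb 1)\otimes y\to\underline{\mathrm{hom}}(x,y)$ is invertible for all $y$). Let $f^*:\mathcal D\to\mathcal C$ be a strong symmetric monoidal triangulated functor that preserves small coproducts. Then $f^*$ has a right adjoint $f_*$, which has a right adjoint $f^{(1)}$. Moreover, for any such adjunctions $f^*\dashv f_*\dashv f^{(1)}$ and any $\kappa\in\mathcal D$ the following holds. Put $\kappa'=f^{(1)}(\kappa)$. For an object $\lambda$ of $\mathcal C$ or $\mathcal D$ write $\Delta_\lambda=\underline{\mathrm{hom}}(-,\lambda)$, and let $\varpi_x:x\to\Delta_\lambda\Delta_\lambda(x)$ be the canonical map, adjoint to $\Delta_\lambda(x)\otimes x\cong x\otimes\Delta_\lambda(x)\xrightarrow{\mathrm{ev}}\lambda$; it is natural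 and satisfies $\Delta_\lambda(\varpi_x)\circ\varpi_{\Delta_\lambda(x)}=\mathrm{id}$. For $d\in\mathcal D$ and $x\in\mathcal C$ let $\pi:d\otimes f_*(x)\to f_*(f^*(d)\otimes x)$ be the projection map, adjoint to $f^*(d\otimes f_*(x))\cong f^*(d)\otimes f^*f_*(x)\to f^*(d)\otimes x$. For fixed $x$, the map $\pi$ of functors of $d$ induces on right adjoints a natural map $f_*\,\underline{\mathrm{hom}}(x,f^{(1)}(-))\to\underline{\mathrm{hom}}(f_*(x),-)$. There is a natural isomorphism $$\zeta:\ \Delta_\kappa\circ f_*\ \xrightarrow{\ \sim\ }\ f_*\circ\Delta_{\kappa'}$$ of functors $\mathcal C^{\mathrm{op}}\to\mathcal D$ whose inverse at each $x$ is this induced map evaluated at $\kappa$. It is compatible with the maps $\varpi$: for every $x\in\mathcal C$, $$\zeta^{-1}_{\Delta_{\kappa'}(x)}\circ f_*(\varpi_x)\;=\;\Delta_\kappa(\zeta^{-1}_x)\circ\varpi_{f_*(x)}\ :\quad f_*(x)\longrightarrow\Delta_\kappa f_*\Delta_{\kappa'}(x).$$ In other words, $(f_*,\zeta^{-1})$ is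 a duality-preserving functor from the category with (weak) duality $(\mathcal C,\Delta_{\kappa'},\varpi)$ to $(\mathcal D,\Delta_\kappa,\varpi)$. -/

import Mathlib

open CategoryTheory CategoryTheory.Limits CategoryTheory.MonoidalCategory Opposite

universe v u u₁ u₂

noncomputable section

namespace TensorDuality

/-! ### Rigidly-compactly generated tensor-triangulated categories -/

section Hypotheses

open Pretriangulated

variable (C : Type u) [Category.{v} C]

open Pretriangulated.Opposite in
/-- Compatibility of a closed symmetric monoidal structure with a triangulation: a natural and
coherent isomorphism `ΣX ⊗ Y ≅ Σ(X ⊗ Y)`, exactness of the tensor product and of the internal hom,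
and the sign rule for the symmetry of `Σ𝟙 ⊗ Σ𝟙`.  (Exactness in the other variable of the tensor
product, resp. of the covariant internal hom, follows by symmetry, resp. by adjunction.) -/
class TensorTriangulated [MonoidalCategory C] [SymmetricCategory C] [MonoidalClosed C]
    [HasZeroObject C] [HasShift C ℤ] [Preadditive C] [∀ n : ℤ, (shiftFunctor C n).Additive]
    [Pretriangulated C] [IsTriangulated C] where
  /-- The isomorphism `ΣX ⊗ Y ≅ Σ(X ⊗ Y)`. -/
  shiftTensor (X Y : C) : X⟦(1 : ℤ)⟧ ⊗ Y ≅ (X ⊗ Y)⟦(1 : ℤ)⟧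
  shiftTensor_natural {X X' Y Y' : C} (f : X ⟶ X') (g : Y ⟶ Y') :
    (f⟦(1 : ℤ)⟧' ⊗ₘ g) ≫ (shiftTensor X' Y').hom =
      (shiftTensor X Y).hom ≫ (f ⊗ₘ g)⟦(1 : ℤ)⟧'
  shiftTensor_unit (X : C) :
    (shiftTensor X (𝟙_ C)).hom ≫ (ρ_ X).hom⟦(1 : ℤ)⟧' = (ρ_ (X⟦(1 : ℤ)⟧)).hom
  shiftTensor_assoc (X Y Z : C) :
    (shiftTensor X Y).hom ▷ Z ≫ (shiftTensor (X ⊗ Y) Z).hom ≫ (α_ X Y Z).hom⟦(1 : ℤ)⟧' =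
      (α_ (X⟦(1 : ℤ)⟧) Y Z).hom ≫ (shiftTensor X (Y ⊗ Z)).hom
  tensor_distinguished (T : Triangle C) (hT : T ∈ distTriang C) (W : C) :
    Triangle.mk (T.mor₁ ▷ W) (T.mor₂ ▷ W) (T.mor₃ ▷ W ≫ (shiftTensor T.obj₁ W).hom) ∈ distTriang C
  ihom_exact (W : C) :
    ∃ _ : (MonoidalClosed.internalHom.flip.obj W).CommShift ℤ,
      (MonoidalClosed.internalHom.flip.obj W).IsTriangulated
  braiding_sign :
    (β_ ((𝟙_ C)⟦(1 : ℤ)⟧) ((𝟙_ C)⟦(1 : ℤ)⟧)).hom = -𝟙 _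

variable {C}

/-- `t` is compact: `Hom(t, -)`, with values in abelian groups, preserves small coproducts. -/
def IsCompactObject [Preadditive C] (t : C) : Prop :=
  ∀ J : Type v, PreservesColimitsOfShape (Discrete J) (preadditiveCoyoneda.obj (op t))

/-- The natural map `[x, 𝟙] ⊗ y ⟶ [x, y]`. -/
def dualTensorHom [MonoidalCategory C] [MonoidalClosed C] (x y : C) :
    (ihom x).obj (𝟙_ C) ⊗ y ⟶ (ihom x).obj y :=
  MonoidalClosed.curry
    ((α_ x ((ihom x).obj (𝟙_ C)) y).inv ≫ (ihom.ev x).app (𝟙_ C) ▷ y ≫ (λ_ y).hom)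

/-- `x` is rigid: `[x, 𝟙] ⊗ y ⟶ [x, y]` is an isomorphism for all `y`. -/
def IsRigidObject [MonoidalCategory C] [MonoidalClosed C] (x : C) : Prop :=
  ∀ y : C, IsIso (dualTensorHom x y)

variable (C)

/-- A preadditive (in practice, triangulated) category is compactly generated if it has small
coproducts and a small set of compact objects that detects zero objects. -/
def IsCompactlyGeneratedCat [Preadditive C] : Prop :=
  HasCoproducts.{v} C ∧
    ∃ G : Set C, Small.{v} G ∧ (∀ g ∈ G, IsCompactObject g) ∧
      ∀ t : C, (∀ g ∈ G, ∀ f : g ⟶ t, f = 0) → IsZero t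

/-- Rigidly-compactly generated: compactly generated, and compact objects are exactly the rigid
objects. -/
class RigidlyCompactlyGenerated [MonoidalCategory C] [MonoidalClosed C] [Preadditive C] :
    Prop where
  compactlyGenerated : IsCompactlyGeneratedCat C
  compact_iff_rigid (x : C) : IsCompactObject x ↔ IsRigidObject x

end Hypotheses

/-! ### Categories with duality -/

/-- A category with (weak) duality: a contravariant endofunctor `D` with a natural map
`ϖ : x ⟶ D D x`, not required to be invertible, such that `D(ϖ_x) ∘ ϖ_{D x} = id`. -/
structure WeakDuality (C : Type u) [Category.{v} C] where
  /-- The duality functor. -/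
  dual : Cᵒᵖ ⥤ C
  /-- The canonical map to the double dual. -/
  bidual : 𝟭 C ⟶ dual.rightOp ⋙ dual
  triangle (x : C) :
    bidual.app (dual.obj (op x)) ≫ dual.map (bidual.app x).op = 𝟙 (dual.obj (op x))

/-- The pair `(F, φ)`, with `φ : F D₁ ⟶ D₂ F`, is a duality-preserving functor. -/
def IsDualityPreserving {C : Type u₁} [Category.{v} C] {D : Type u₂} [Category.{v} D]
    (W₁ : WeakDuality C) (W₂ : WeakDuality D) (F : C ⥤ D)
    (φ : W₁.dual ⋙ F ⟶ F.op ⋙ W₂.dual) : Prop :=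
  ∀ x : C,
    F.map (W₁.bidual.app x) ≫ φ.app (op (W₁.dual.obj (op x))) =
      W₂.bidual.app (F.obj x) ≫ W₂.dual.map (φ.app (op x)).op

section Twisted

variable {C : Type u} [Category.{v} C] [MonoidalCategory C] [SymmetricCategory C]
  [MonoidalClosed C]

/-- The `κ`-twisted dual `D_κ = [-, κ]`. -/
abbrev twistedDual (κ : C) : Cᵒᵖ ⥤ C :=
  MonoidalClosed.internalHom.flip.obj κ

/-- The map `x ⟶ D_κ D_κ x` adjoint to `D_κ x ⊗ x ≅ x ⊗ D_κ x ⟶ κ`. -/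
def bidualMap (κ x : C) : x ⟶ (ihom ((ihom x).obj κ)).obj κ :=
  MonoidalClosed.curry (A := (ihom x).obj κ)
    ((β_ ((ihom x).obj κ) x).hom ≫ (ihom.ev x).app κ)

theorem bidualMap_natural (κ : C) {x y : C} (f : x ⟶ y) :
    f ≫ bidualMap κ y =
      bidualMap κ x ≫ (MonoidalClosed.pre ((MonoidalClosed.pre f).app κ)).app κ := by
  rw [bidualMap, bidualMap, MonoidalClosed.curry_pre_app, ← MonoidalClosed.curry_natural_left]
  congr 1
  rw [BraidedCategory.braiding_naturality_right_assoc,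
    BraidedCategory.braiding_naturality_left_assoc,
    MonoidalClosed.id_tensor_pre_app_comp_ev]

theorem bidualMap_triangle (κ x : C) :
    bidualMap κ ((ihom x).obj κ) ≫ (MonoidalClosed.pre (bidualMap κ x)).app κ =
      𝟙 ((ihom x).obj κ) := by
  rw [bidualMap, MonoidalClosed.curry_pre_app, MonoidalClosed.curry_eq_iff,
    BraidedCategory.braiding_naturality_left_assoc, bidualMap,
    MonoidalClosed.whiskerLeft_curry_ihom_ev_app, MonoidalClosed.uncurry_id_eq_ev,
    SymmetricCategory.symmetry_assoc]

/-- The `κ`-twisted duality on `C`. -/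
def twistedDuality (κ : C) : WeakDuality C where
  dual := twistedDual κ
  bidual :=
    { app := fun x => bidualMap κ x
      naturality := fun _ _ f => bidualMap_natural κ f }
  triangle x := bidualMap_triangle κ x

end Twisted

/-! ### The projection formula and the internal adjunction -/

section Projection

variable {C : Type u₁} [Category.{v} C] [MonoidalCategory C] [SymmetricCategory C]
  [MonoidalClosed C]
variable {D : Type u₂} [Category.{v} D] [MonoidalCategory D] [SymmetricCategory D]
  [MonoidalClosed D]

/-- The adjunction `- ⊗ y ⊣ [y, -]`. -/
def tensorRightAdjunction (y : C) : tensorRight y ⊣ ihom y :=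
  (ihom.adjunction y).ofNatIsoLeft (BraidedCategory.tensorLeftIsoTensorRight y)

variable {fpull : D ⥤ C} [fpull.Monoidal] {fpush : C ⥤ D} {ftwist : D ⥤ C}

/-- The projection map `π : x ⊗ f_* y ⟶ f_* (f^* x ⊗ y)`, adjoint to
`f^* (x ⊗ f_* y) ≅ f^* x ⊗ f^* f_* y ⟶ f^* x ⊗ y`, as a natural transformation in `x`. -/
def projection (adj₁ : fpull ⊣ fpush) (y : C) :
    tensorRight (fpush.obj y) ⟶ (fpull ⋙ tensorRight y) ⋙ fpush where
  app x := adj₁.homEquiv _ _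
    (Functor.OplaxMonoidal.δ fpull x (fpush.obj y) ≫ fpull.obj x ◁ adj₁.counit.app y)
  naturality := by
    intro x x' g
    change (g ▷ fpush.obj y) ≫ adj₁.homEquiv _ _ _ =
      adj₁.homEquiv _ _ _ ≫ fpush.map (fpull.map g ▷ y)
    rw [← Adjunction.homEquiv_naturality_left, ← Adjunction.homEquiv_naturality_right]
    congr 1
    rw [← Functor.OplaxMonoidal.δ_natural_left_assoc, Category.assoc, whisker_exchange]

/-- The natural map `f_* [x, f^(1) -] ⟶ [f_* x, -]` obtained from the projection map
`- ⊗ f_* x ⟶ f_* (f^* - ⊗ x)` by passing to right adjoints. -/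
def pushIhom (adj₁ : fpull ⊣ fpush) (adj₂ : fpush ⊣ ftwist) (x : C) :
    ftwist ⋙ ihom x ⋙ fpush ⟶ ihom (fpush.obj x) :=
  conjugateEquiv ((adj₁.comp (tensorRightAdjunction x)).comp adj₂)
    (tensorRightAdjunction (fpush.obj x)) (projection adj₁ x)

end Projection

end TensorDuality

end

/-! Existence of the adjoints is Brown representability, in the form
`IsCompactlyGeneratedCat.isLeftAdjoint`: a coproduct-preserving exact functor `F` out of a compactly
generated category has a right adjoint. For each `d` one builds by cell attachment an object over
`d` representing `Hom(F -, d)` on the generators, and shows that it is terminal among objects over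
`d`. This applies to `f^*`. A strong monoidal functor preserves dual pairings, hence rigid objects,
hence compact ones; so `f_*` preserves coproducts, it is exact as the adjoint of an exact functor,
and the theorem applies again.

For the isomorphism, `pushIhom` is the mate of the projection map, so `Hom(d, pushIhom)` is
precomposition with `π` at `d`, up to the adjunctions. For rigid `d` the map `π` is invertible: move
the dual of `d` to the other side. The compact generators are rigid, and a map that is bijective on
maps from generators is invertible, so the projection formula for general `d` is not needed.

Compatibility with `ϖ` holds because `f_*` is lax symmetric monoidal and the adjunct of `pushIhom`
is the lax structure map, then `f_*(ev)`, then the counit of `f_* ⊣ f^(1)` (`uncurry_pushIhom`). -/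

noncomputable section

namespace TensorDuality

/-! ### Maps out of compact objects -/

section Compact

variable {C : Type u} [Category.{v} C] [Preadditive C]

/-- A subgroup of maps from a compact object to a coproduct is everything as soon as it contains
the maps that factor through a summand. -/
theorem IsCompactObject.mem_of_factors {t : C} (ht : IsCompactObject t) {J : Type v} (X : J → C)
    [HasCoproduct X] (S : AddSubgroup (t ⟶ ∐ X))
    (hS : ∀ (j : J) (f : t ⟶ X j), f ≫ Sigma.ι X j ∈ S) (f : t ⟶ ∐ X) : f ∈ S := by
  have := ht J
  let q : (preadditiveCoyoneda.obj (op t)).obj (∐ X) ⟶ AddCommGrpCat.of ((t ⟶ ∐ X) ⧸ S) :=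
    AddCommGrpCat.ofHom (QuotientAddGroup.mk' S)
  -- By compactness `Hom(t, ∐ X)` is the coproduct of the groups `Hom(t, X j)`, so the quotient map
  -- can be tested on summands.
  have hq : q = 0 := by
    refine (isColimitOfPreserves (preadditiveCoyoneda.obj (op t))
      (coproductIsCoproduct X)).hom_ext ?_
    rintro ⟨j⟩
    ext g
    exact (QuotientAddGroup.eq_zero_iff (N := S) _).2 (hS j g)
  have h0 : q.hom f = 0 := by rw [hq]; rfl
  exact (QuotientAddGroup.eq_zero_iff (N := S) f).1 h0

/-- A map from a compact object to a coproduct whose coordinates vanish is zero. -/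
theorem IsCompactObject.eq_zero_of_coordinates {t : C} (ht : IsCompactObject t) {J : Type v}
    (X : J → C) [HasCoproduct X] (π : ∀ j, ∐ X ⟶ X j)
    (hπ : ∀ j, Sigma.ι X j ≫ π j = 𝟙 _) (hπ' : ∀ i j, i ≠ j → Sigma.ι X i ≫ π j = 0)
    (f : t ⟶ ∐ X) (hf : ∀ j, f ≫ π j = 0) : f = 0 := by
  classical
  let Φ : (DirectSum J fun j => t ⟶ X j) →+ (t ⟶ ∐ X) :=
    DirectSum.toAddMonoid fun j => Preadditive.rightComp t (Sigma.ι X j)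
  obtain ⟨x, rfl⟩ : f ∈ Φ.range := ht.mem_of_factors X _ (fun j g =>
    AddMonoidHom.mem_range.2
      ⟨DirectSum.of (fun j => t ⟶ X j) j g, DirectSum.toAddMonoid_of _ _ _⟩) f
  have hx : ∀ (y : DirectSum J fun j => t ⟶ X j) (j : J), Φ y ≫ π j = y j := by
    intro y j
    induction y using DirectSum.induction_on with
    | zero => simp
    | of i g =>
      rw [show Φ (DirectSum.of _ i g) = g ≫ Sigma.ι X i from DirectSum.toAddMonoid_of _ _ _,
        Category.assoc]
      by_cases hij : i = j
      · subst hij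
        rw [hπ, Category.comp_id, DirectSum.of_eq_same]
      · rw [hπ' i j hij, DirectSum.of_eq_of_ne _ _ _ (Ne.symm hij)]
        exact comp_zero
    | add y z hy hz => rw [map_add, Preadditive.add_comp, hy, hz]; rfl
  have : x = 0 := by
    ext j
    rw [← hx x j]
    exact hf j
  rw [this, map_zero]

/-- Compactness is invariant under shifts. -/
theorem IsCompactObject.shift [HasShift C ℤ] [∀ n : ℤ, (shiftFunctor C n).Additive]
    {t : C} (ht : IsCompactObject t) (n : ℤ) : IsCompactObject (t⟦n⟧) := by
  intro J
  have := ht J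
  let adj : shiftFunctor C n ⊣ shiftFunctor C (-n) := (shiftEquiv C n).toAdjunction
  let e : shiftFunctor C (-n) ⋙ preadditiveCoyoneda.obj (op t) ≅
      preadditiveCoyoneda.obj (op (t⟦n⟧)) :=
    NatIso.ofComponents
      (fun X => AddEquiv.toAddCommGrpIso
        (X := AddCommGrpCat.of (t ⟶ X⟦-n⟧)) (Y := AddCommGrpCat.of (t⟦n⟧ ⟶ X))
        { toEquiv := (adj.homEquiv t X).symm
          map_add' := fun f g => by
            change (adj.homEquiv t X).symm (f + g) =
              (adj.homEquiv t X).symm f +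
              (adj.homEquiv t X).symm g
            simp only [Adjunction.homEquiv_counit]
            exact (congrArg (· ≫ _) ((shiftFunctor C n).map_add)).trans
              (Preadditive.add_comp _ _ _ _ _ _) })
      (fun {X Y} f => by
        ext g
        exact adj.homEquiv_naturality_right_symm g f)
  exact preservesColimitsOfShape_of_natIso e

end Compact

/-! ### Generating families and detection of isomorphisms -/

section Detection

open Pretriangulated

variable {C : Type u} [Category.{v} C] [Preadditive C] [HasShift C ℤ]

/-- A small family of compact objects, stable under desuspension, that detects zero objects. -/
structure IsGeneratingFamily {K : Type v} (T : K → C) : Prop where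
  compact (k : K) : IsCompactObject (T k)
  desuspension (k : K) : ∃ k', Nonempty ((T k)⟦(-1 : ℤ)⟧ ≅ T k')
  isZero (Z : C) : (∀ (k : K) (f : T k ⟶ Z), f = 0) → IsZero Z

variable [∀ n : ℤ, (shiftFunctor C n).Additive]

/-- Take all shifts of the given generators; the shift by `0` keeps the detection property. -/
theorem IsCompactlyGeneratedCat.exists_isGeneratingFamily (h : IsCompactlyGeneratedCat C) :
    ∃ (K : Type v) (T : K → C), IsGeneratingFamily T := by
  obtain ⟨_, G, _, hG, hz⟩ := h
  refine ⟨Shrink.{v} G × ULift.{v} ℤ,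
    fun k => ((equivShrink G).symm k.1 : C)⟦k.2.down⟧, ?_, ?_, ?_⟩
  · exact fun k => (hG _ ((equivShrink G).symm k.1).2).shift _
  · rintro ⟨g, ⟨n⟩⟩
    exact ⟨⟨g, ⟨n + (-1)⟩⟩, ⟨((shiftFunctorAdd C n (-1)).app _).symm⟩⟩
  · intro Z hZ
    refine hz Z fun g hg f => ?_
    have h1 : ∀ f' : ((equivShrink G).symm (equivShrink G ⟨g, hg⟩) : C)⟦(0 : ℤ)⟧ ⟶ Z, f' = 0 :=
      hZ ⟨equivShrink G ⟨g, hg⟩, ⟨0⟩⟩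
    rw [Equiv.symm_apply_apply] at h1
    have h2 := h1 ((shiftFunctorZero C ℤ).hom.app g ≫ f)
    rw [← cancel_epi ((shiftFunctorZero C ℤ).hom.app g), h2, comp_zero]

/-- If `f` is injective on maps out of a generating family, then so is its suspension. -/
theorem IsGeneratingFamily.eq_zero_of_comp_shift {K : Type v} {T : K → C}
    (hT : IsGeneratingFamily T) {A B : C} (f : A ⟶ B)
    (hf : ∀ (k : K) (g : T k ⟶ A), g ≫ f = 0 → g = 0) (k : K) (g : T k ⟶ A⟦(1 : ℤ)⟧)
    (hg : g ≫ f⟦(1 : ℤ)⟧' = 0) : g = 0 := by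
  obtain ⟨k', ⟨e⟩⟩ := hT.desuspension k
  let adj : shiftFunctor C (-1 : ℤ) ⊣ shiftFunctor C (1 : ℤ) :=
    (shiftEquiv' C (-1 : ℤ) 1 (by simp)).toAdjunction
  obtain ⟨g', rfl⟩ := (adj.homEquiv (T k) A).surjective g
  have h1 : adj.homEquiv _ _ (g' ≫ f) = adj.homEquiv _ _ 0 := by
    refine (adj.homEquiv_naturality_right g' f).trans (hg.trans ?_)
    rw [Adjunction.homEquiv_unit]
    exact (comp_zero (f := adj.unit.app (T k))).symm.trans
      (congrArg _ ((shiftFunctor C (1 : ℤ)).map_zero _ _).symm)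
  have h2 : g' ≫ f = 0 := (adj.homEquiv _ _).injective h1
  have h3 : e.inv ≫ g' = 0 := hf k' _ (by rw [Category.assoc, h2, comp_zero])
  have h4 : g' = 0 := by rw [← cancel_epi e.inv, h3, comp_zero]
  rw [h4, Adjunction.homEquiv_unit]
  exact (congrArg _ ((shiftFunctor C (1 : ℤ)).map_zero _ _)).trans comp_zero

variable [HasZeroObject C] [Pretriangulated C]

/-- A map inducing bijections on maps from a generating family is an isomorphism. -/
theorem IsGeneratingFamily.isIso {K : Type v} {T : K → C} (hT : IsGeneratingFamily T)
    {A B : C} (f : A ⟶ B) (hinj : ∀ (k : K) (g : T k ⟶ A), g ≫ f = 0 → g = 0)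
    (hsurj : ∀ (k : K) (g : T k ⟶ B), ∃ g', g' ≫ f = g) : IsIso f := by
  -- The cone has no maps from generators: by injectivity such a map dies in `A⟦1⟧`, so it lifts to
  -- `B`, hence to `A` by surjectivity, and is zero.
  obtain ⟨Z, p, δ, hZ⟩ := distinguished_cocone_triangle f
  refine (Triangle.isZero₃_iff_isIso₁ _ hZ).1 (hT.isZero Z fun k h => ?_)
  have h1 : h ≫ δ = 0 := by
    refine hT.eq_zero_of_comp_shift f hinj k _ ?_
    rw [Category.assoc]
    exact (congrArg _ (comp_distTriang_mor_zero₃₁ _ hZ)).trans comp_zero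
  obtain ⟨b, rfl⟩ := Triangle.coyoneda_exact₃ _ hZ h h1
  obtain ⟨a, rfl⟩ := hsurj k b
  exact (Category.assoc _ _ _).trans
    ((congrArg _ (comp_distTriang_mor_zero₁₂ _ hZ)).trans comp_zero)

end Detection

/-! ### Brown representability for coproduct-preserving exact functors -/

section MapSigma

variable {C : Type u₁} [Category.{v} C] {D : Type u₂} [Category.{v} D] (F : C ⥤ D)
  {J : Type v} [PreservesColimitsOfShape (Discrete J) F] (X : J → C) [HasCoproduct X]

/-- The image of a coproduct under a functor preserving it is a coproduct. -/
def mapSigmaIsColimit :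
    IsColimit (Cofan.mk (F.obj (∐ X)) fun j => F.map (Sigma.ι X j)) :=
  isColimitCofanMkObjOfIsColimit F _ _ (coproductIsCoproduct X)

theorem map_sigma_hom_ext {Z : D} {f g : F.obj (∐ X) ⟶ Z}
    (h : ∀ j, F.map (Sigma.ι X j) ≫ f = F.map (Sigma.ι X j) ≫ g) : f = g :=
  Cofan.IsColimit.hom_ext (mapSigmaIsColimit F X) _ _ h

theorem exists_map_sigma_desc {Z : D} (φ : ∀ j, F.obj (X j) ⟶ Z) :
    ∃ f : F.obj (∐ X) ⟶ Z, ∀ j, F.map (Sigma.ι X j) ≫ f = φ j :=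
  ⟨Cofan.IsColimit.desc (mapSigmaIsColimit F X) φ,
    fun j => Cofan.IsColimit.fac (mapSigmaIsColimit F X) φ j⟩

end MapSigma

section Extension

open Pretriangulated

variable {C : Type u₁} [Category.{v} C] [Preadditive C] [HasZeroObject C] [HasShift C ℤ]
  [∀ n : ℤ, (shiftFunctor C n).Additive] [Pretriangulated C]
  {D : Type u₂} [Category.{v} D] [Preadditive D] [HasZeroObject D] [HasShift D ℤ]
  [∀ n : ℤ, (shiftFunctor D n).Additive] [Pretriangulated D]
  (F : C ⥤ D) [F.CommShift ℤ] [F.IsTriangulated]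

/-- A map out of `F Y` that vanishes on `F X` extends along the image of a distinguished triangle
`X ⟶ Y ⟶ Z`. -/
theorem exists_map_extension {X Y Z : C} {f : X ⟶ Y} {g : Y ⟶ Z} {δ : Z ⟶ X⟦(1 : ℤ)⟧}
    (hT : Triangle.mk f g δ ∈ distTriang C) {d : D} (e : F.obj Y ⟶ d) (he : F.map f ≫ e = 0) :
    ∃ e' : F.obj Z ⟶ d, F.map g ≫ e' = e := by
  obtain ⟨e', h⟩ := Triangle.yoneda_exact₂ _ (F.map_distinguished _ hT) e he
  exact ⟨e', h.symm⟩

end Extension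

/-! ### Homotopy colimits of sequences -/

section Telescope

open Pretriangulated

variable {C : Type u₁} [Category.{v} C] [HasCoproducts.{v} C]

variable (X : ℕ → C) (s : ∀ n, X n ⟶ X (n + 1))

/-- The self-map of `∐ X n` induced by the transition maps `X n ⟶ X (n + 1)`. -/
def sigmaShift : (∐ fun n : ULift.{v} ℕ => X n.down) ⟶ ∐ fun n : ULift.{v} ℕ => X n.down :=
  Sigma.desc fun n => s n.down ≫ Sigma.ι (fun n : ULift.{v} ℕ => X n.down) ⟨n.down + 1⟩

theorem ι_sigmaShift (n : ℕ) :
    Sigma.ι (fun n : ULift.{v} ℕ => X n.down) ⟨n⟩ ≫ sigmaShift X s =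
      s n ≫ Sigma.ι (fun n : ULift.{v} ℕ => X n.down) ⟨n + 1⟩ :=
  Sigma.ι_desc _ _

variable [Preadditive C]

theorem sigmaShift_π_zero :
    sigmaShift X s ≫ Sigma.π (fun n : ULift.{v} ℕ => X n.down) ⟨0⟩ = 0 := by
  refine Sigma.hom_ext _ _ ?_
  rintro ⟨n⟩
  rw [reassoc_of% (ι_sigmaShift X s n), comp_zero,
    Sigma.ι_π_of_ne _ (by simp [ULift.ext_iff]), comp_zero]

theorem sigmaShift_π_succ (n : ℕ) :
    sigmaShift X s ≫ Sigma.π (fun n : ULift.{v} ℕ => X n.down) ⟨n + 1⟩ =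
      Sigma.π (fun n : ULift.{v} ℕ => X n.down) ⟨n⟩ ≫ s n := by
  refine Sigma.hom_ext _ _ ?_
  rintro ⟨m⟩
  rw [reassoc_of% (ι_sigmaShift X s m)]
  by_cases h : m = n
  · subst h
    rw [Sigma.ι_π_eq_id, Category.comp_id, ← Category.assoc, Sigma.ι_π_eq_id, Category.id_comp]
  · rw [Sigma.ι_π_of_ne _ (by simpa [ULift.ext_iff] using h), comp_zero, ← Category.assoc,
      Sigma.ι_π_of_ne _ (by simpa [ULift.ext_iff] using h), zero_comp]

/-- A map fixed by the shift has zero coordinate at `0`, since nothing is shifted there, and each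
later coordinate is determined by the preceding one. -/
theorem IsCompactObject.eq_zero_of_comp_one_sub_sigmaShift {t : C} (ht : IsCompactObject t)
    (f : t ⟶ ∐ fun n : ULift.{v} ℕ => X n.down) (hf : f ≫ (𝟙 _ - sigmaShift X s) = 0) :
    f = 0 := by
  have hf' : f = f ≫ sigmaShift X s := by
    rw [Preadditive.comp_sub, Category.comp_id, sub_eq_zero] at hf
    exact hf
  refine ht.eq_zero_of_coordinates _ (fun j => Sigma.π _ j) (fun j => Sigma.ι_π_eq_id _ j)
    (fun i j h => Sigma.ι_π_of_ne _ h) f ?_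
  rintro ⟨n⟩
  induction n with
  | zero => rw [hf', Category.assoc, sigmaShift_π_zero, comp_zero]
  | succ n ih => rw [hf', Category.assoc, sigmaShift_π_succ, reassoc_of% ih, zero_comp]

variable [HasZeroObject C] [HasShift C ℤ] [∀ n : ℤ, (shiftFunctor C n).Additive]
  [Pretriangulated C]
  {D : Type u₂} [Category.{v} D] [Preadditive D] [HasZeroObject D] [HasShift D ℤ]
  [∀ n : ℤ, (shiftFunctor D n).Additive] [Pretriangulated D]
  (F : C ⥤ D) [F.CommShift ℤ] [F.IsTriangulated]

/-- Existence of a homotopy colimit `Y` of a sequence `X`: maps out of the image of the sequence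
under `F` extend to `F Y`, and maps from compacts to `Y` factor through the sequence. -/
theorem exists_telescope [∀ J : Type v, PreservesColimitsOfShape (Discrete J) F] :
    ∃ (Y : C) (j : ∀ n, X n ⟶ Y), (∀ n, s n ≫ j (n + 1) = j n) ∧
      (∀ (d : D) (e : ∀ n, F.obj (X n) ⟶ d), (∀ n, F.map (s n) ≫ e (n + 1) = e n) →
        ∃ e' : F.obj Y ⟶ d, ∀ n, F.map (j n) ≫ e' = e n) ∧
      ∀ {K : Type v} {T : K → C}, IsGeneratingFamily T → ∀ (k : K) (f : T k ⟶ Y),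
        ∃ (n : ℕ) (g : T k ⟶ X n), g ≫ j n = f := by
  obtain ⟨Y, p, δ, hY⟩ := distinguished_cocone_triangle
    (𝟙 (∐ fun n : ULift.{v} ℕ => X n.down) - sigmaShift X s)
  have hp : sigmaShift X s ≫ p = p := by
    have h : (𝟙 _ - sigmaShift X s) ≫ p = 0 := comp_distTriang_mor_zero₁₂ _ hY
    rw [Preadditive.sub_comp, Category.id_comp, sub_eq_zero] at h
    exact h.symm
  have hs : ∀ n, s n ≫ Sigma.ι (fun n : ULift.{v} ℕ => X n.down) ⟨n + 1⟩ ≫ p =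
      Sigma.ι (fun n : ULift.{v} ℕ => X n.down) ⟨n⟩ ≫ p := fun n => by
    rw [← reassoc_of% (ι_sigmaShift X s n), hp]
  refine ⟨Y, fun n => Sigma.ι (fun n : ULift.{v} ℕ => X n.down) ⟨n⟩ ≫ p, hs, ?_, ?_⟩
  · intro d e he
    obtain ⟨e₁, h₁⟩ := exists_map_sigma_desc F (fun n : ULift.{v} ℕ => X n.down)
      fun n => e n.down
    obtain ⟨e₂, h₂⟩ := exists_map_extension F hY e₁ (by
      refine map_sigma_hom_ext F _ ?_
      rintro ⟨n⟩
      rw [← Functor.map_comp_assoc, Preadditive.comp_sub, Category.comp_id, ι_sigmaShift,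
        Functor.map_sub, Preadditive.sub_comp, Functor.map_comp_assoc, h₁, h₁, he, sub_self,
        comp_zero])
    refine ⟨e₂, fun n => ?_⟩
    change F.map (_ ≫ p) ≫ e₂ = e n
    rw [Functor.map_comp_assoc, h₂]
    exact h₁ ⟨n⟩
  · intro K T hT k f
    have hδ : f ≫ δ = 0 := by
      refine hT.eq_zero_of_comp_shift (𝟙 _ - sigmaShift X s)
        (fun k g hg => (hT.compact k).eq_zero_of_comp_one_sub_sigmaShift X s g hg) k _ ?_
      rw [Category.assoc]
      exact (congrArg _ (comp_distTriang_mor_zero₃₁ _ hY)).trans comp_zero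
    obtain ⟨h, rfl⟩ := Triangle.coyoneda_exact₃ _ hY f hδ
    have hmono : ∀ (n m : ℕ), n ≤ m → ∀ g : T k ⟶ X n, ∃ g' : T k ⟶ X m,
        g' ≫ Sigma.ι (fun n : ULift.{v} ℕ => X n.down) ⟨m⟩ ≫ p =
          g ≫ Sigma.ι (fun n : ULift.{v} ℕ => X n.down) ⟨n⟩ ≫ p := by
      intro n m hnm g
      induction m, hnm using Nat.le_induction with
      | base => exact ⟨g, rfl⟩
      | succ m _ ih =>
        obtain ⟨g', hg'⟩ := ih
        exact ⟨g' ≫ s m, by rw [Category.assoc, hs, hg']⟩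
    -- Maps whose image in `Y` comes from a finite stage. They are closed under addition because two
    -- stages can be compared at a later one (`hmono`).
    let S : AddSubgroup (T k ⟶ ∐ fun n : ULift.{v} ℕ => X n.down) :=
      { carrier := {h | ∃ (n : ℕ) (g : T k ⟶ X n),
          g ≫ Sigma.ι (fun n : ULift.{v} ℕ => X n.down) ⟨n⟩ ≫ p = h ≫ p}
        zero_mem' := ⟨0, 0, by rw [zero_comp, zero_comp]⟩
        add_mem' := by
          rintro a b ⟨n, g, hg⟩ ⟨m, g', hg'⟩
          obtain ⟨a₁, h₁⟩ := hmono n _ (le_max_left n m) g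
          obtain ⟨b₁, h₂⟩ := hmono m _ (le_max_right n m) g'
          exact ⟨max n m, a₁ + b₁, by
            rw [Preadditive.add_comp, Preadditive.add_comp, h₁, h₂, hg, hg']⟩
        neg_mem' := by
          rintro a ⟨n, g, hg⟩
          exact ⟨n, -g, by rw [Preadditive.neg_comp, Preadditive.neg_comp, hg]⟩ }
    exact (hT.compact k).mem_of_factors _ S (fun j g => ⟨j.down, g, (Category.assoc _ _ _).symm⟩) h

end Telescope

/-! ### Universal objects over `d` and the right adjoint -/

section Brown

open Pretriangulated

variable {C : Type u₁} [Category.{v} C] [Preadditive C] [HasZeroObject C] [HasShift C ℤ]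
  [∀ n : ℤ, (shiftFunctor C n).Additive] [Pretriangulated C]
  {D : Type u₂} [Category.{v} D] [Preadditive D] [HasZeroObject D] [HasShift D ℤ]
  [∀ n : ℤ, (shiftFunctor D n).Additive] [Pretriangulated D]
  (F : C ⥤ D)

/-- A map `F x ⟶ d` is `T`-universal if it represents `Hom(F -, d)` on the family `T`. -/
def IsUniversalOn {F : C ⥤ D} {K : Type v} (T : K → C) {d : D} (E : CostructuredArrow F d) :
    Prop :=
  ∀ k, (∀ h : T k ⟶ E.left, F.map h ≫ E.hom = 0 → h = 0) ∧
    ∀ α : F.obj (T k) ⟶ d, ∃ h : T k ⟶ E.left, F.map h ≫ E.hom = α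

variable [F.CommShift ℤ] [F.IsTriangulated]

theorem IsUniversalOn.isIso_left {K : Type v} {T : K → C} (hT : IsGeneratingFamily T)
    {d : D} {E E' : CostructuredArrow F d} (hE : IsUniversalOn T E) (hE' : IsUniversalOn T E')
    (f : E ⟶ E') : IsIso f.left := by
  refine hT.isIso _ (fun k g hg => ?_) fun k g => ?_
  · refine (hE k).1 g ?_
    rw [← CostructuredArrow.w f, ← Functor.map_comp_assoc, hg, Functor.map_zero, zero_comp]
  · obtain ⟨h, hh⟩ := (hE k).2 (F.map g ≫ E'.hom)
    refine ⟨h, sub_eq_zero.1 ((hE' k).1 _ ?_)⟩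
    rw [Functor.map_sub, Preadditive.sub_comp, Functor.map_comp_assoc, CostructuredArrow.w, hh,
      sub_self]

theorem exists_cospan {d : D} (E₁ E₂ : CostructuredArrow F d) :
    ∃ (S : CostructuredArrow F d) (_ : E₁ ⟶ S), Nonempty (E₂ ⟶ S) := by
  refine ⟨CostructuredArrow.mk (Y := E₁.left ⊞ E₂.left)
    (F.map biprod.fst ≫ E₁.hom + F.map biprod.snd ≫ E₂.hom),
    CostructuredArrow.homMk biprod.inl ?_, ⟨CostructuredArrow.homMk biprod.inr ?_⟩⟩
  · change F.map biprod.inl ≫ (F.map biprod.fst ≫ E₁.hom + F.map biprod.snd ≫ E₂.hom) = E₁.hom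
    rw [Preadditive.comp_add, ← Functor.map_comp_assoc, ← Functor.map_comp_assoc,
      biprod.inl_fst, biprod.inl_snd, CategoryTheory.Functor.map_id, Functor.map_zero, zero_comp,
      add_zero, Category.id_comp]
  · change F.map biprod.inr ≫ (F.map biprod.fst ≫ E₁.hom + F.map biprod.snd ≫ E₂.hom) = E₂.hom
    rw [Preadditive.comp_add, ← Functor.map_comp_assoc, ← Functor.map_comp_assoc,
      biprod.inr_fst, biprod.inr_snd, CategoryTheory.Functor.map_id, Functor.map_zero, zero_comp,
      zero_add, Category.id_comp]

variable [HasCoproducts.{v} C]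
  [∀ J : Type v, PreservesColimitsOfShape (Discrete J) F]

/-- Attach the cone of the coproduct of all maps in the kernel. New kernel elements may appear, so
the step has to be iterated. -/
theorem exists_kill_kernel {K : Type v} (T : K → C) {d : D} (E : CostructuredArrow F d) :
    ∃ (E' : CostructuredArrow F d) (i : E ⟶ E'), ∀ (k : K) (h : T k ⟶ E.left),
      F.map h ≫ E.hom = 0 → h ≫ i.left = 0 := by
  let I := Σ k, {h : T k ⟶ E.left // F.map h ≫ E.hom = 0}
  let a : (∐ fun i : I => T i.1) ⟶ E.left := Sigma.desc fun i => i.2.1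
  obtain ⟨Z, p, δ, hZ⟩ := distinguished_cocone_triangle a
  obtain ⟨e, he⟩ := exists_map_extension F hZ E.hom (map_sigma_hom_ext F _ fun j => by
    rw [← Functor.map_comp_assoc, Sigma.ι_desc, comp_zero]
    exact j.2.2)
  refine ⟨CostructuredArrow.mk e, CostructuredArrow.homMk p he, fun k h hh => ?_⟩
  have h1 : h = Sigma.ι (fun i : I => T i.1) ⟨k, h, hh⟩ ≫ a :=
    (Sigma.ι_desc (f := fun i : I => T i.1) (fun i => i.2.1) ⟨k, h, hh⟩).symm
  have h2 : a ≫ p = 0 := comp_distTriang_mor_zero₁₂ _ hZ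
  change h ≫ p = 0
  rw [h1, Category.assoc, h2, comp_zero]

/-- Add to `E` one summand `T k` for every `α : F (T k) ⟶ d`. The surjectivity obtained is inherited
by every object under `E'`. -/
theorem exists_surjective_start {K : Type v} (T : K → C) {d : D} (E : CostructuredArrow F d) :
    ∃ (E' : CostructuredArrow F d) (_ : E ⟶ E'), ∀ (k : K) (α : F.obj (T k) ⟶ d),
      ∃ h : T k ⟶ E'.left, F.map h ≫ E'.hom = α := by
  obtain ⟨e, he⟩ := exists_map_sigma_desc F (fun i : (Σ k, (F.obj (T k) ⟶ d)) => T i.1)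
    fun i => i.2
  obtain ⟨S, i, ⟨j⟩⟩ := exists_cospan F E (CostructuredArrow.mk e)
  refine ⟨S, i, fun k α =>
    ⟨Sigma.ι (fun i : (Σ k, (F.obj (T k) ⟶ d)) => T i.1) ⟨k, α⟩ ≫ j.left, ?_⟩⟩
  rw [Functor.map_comp_assoc, CostructuredArrow.w]
  exact he ⟨k, α⟩

/-- In the telescope of iterated kernel killings, a map from `T k` lives at a finite stage; if it is
in the kernel, it vanishes at the next stage. -/
theorem exists_isUniversalOn {K : Type v} {T : K → C} (hT : IsGeneratingFamily T) {d : D}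
    (E : CostructuredArrow F d) :
    ∃ (E' : CostructuredArrow F d) (_ : E ⟶ E'), IsUniversalOn T E' := by
  obtain ⟨E₀, i₀, h₀⟩ := exists_surjective_start F T E
  choose next step hstep using fun E : CostructuredArrow F d => exists_kill_kernel F T E
  let X : ℕ → CostructuredArrow F d := fun n => Nat.rec E₀ (fun _ => next) n
  let s : ∀ n, X n ⟶ X (n + 1) := fun n => step (X n)
  obtain ⟨Y, j, hj, hext, hfac⟩ :=
    exists_telescope (fun n => (X n).left) (fun n => (s n).left) F
  obtain ⟨e, he⟩ := hext d (fun n => (X n).hom) fun n => CostructuredArrow.w (s n)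
  refine ⟨CostructuredArrow.mk e, i₀ ≫ CostructuredArrow.homMk (j 0) (he 0), fun k => ⟨?_, ?_⟩⟩
  · intro h hh
    obtain ⟨n, g, rfl⟩ := hfac hT k h
    have h1 : F.map g ≫ (X n).hom = 0 := by
      rw [← he n, ← Functor.map_comp_assoc]
      exact hh
    rw [← hj n, reassoc_of% (hstep (X n) k g h1), zero_comp]
  · intro α
    obtain ⟨h, hh⟩ := h₀ k α
    refine ⟨h ≫ j 0, ?_⟩
    change F.map (h ≫ j 0) ≫ e = α
    rw [Functor.map_comp_assoc, he 0]
    exact hh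

/-- A coproduct-preserving exact functor out of a compactly generated triangulated category has a
right adjoint. -/
theorem IsCompactlyGeneratedCat.isLeftAdjoint (hC : IsCompactlyGeneratedCat C) :
    F.IsLeftAdjoint := by
  obtain ⟨K, T, hT⟩ := hC.exists_isGeneratingFamily
  have (d : D) : HasTerminal (CostructuredArrow F d) := by
    obtain ⟨W, _, hW⟩ := exists_isUniversalOn F hT
      (CostructuredArrow.mk (0 : F.obj (∐ T) ⟶ d))
    -- Every map out of `W` is a split monomorphism: continue it to a universal object, where the
    -- composite is invertible by `IsUniversalOn.isIso_left`.
    have key {E : CostructuredArrow F d} (i : W ⟶ E) :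
        ∃ r : E ⟶ W, i ≫ r = 𝟙 W := by
      obtain ⟨E', j, hE'⟩ := exists_isUniversalOn F hT E
      have : IsIso (i ≫ j).left := hW.isIso_left F hT hE' (i ≫ j)
      have : IsIso ((CostructuredArrow.proj F d).map (i ≫ j)) := this
      have := isIso_of_reflects_iso (i ≫ j) (CostructuredArrow.proj F d)
      exact ⟨j ≫ inv (i ≫ j), by rw [← Category.assoc, IsIso.hom_inv_id]⟩
    have hex (E : CostructuredArrow F d) : Nonempty (E ⟶ W) := by
      obtain ⟨S, i, ⟨j⟩⟩ := exists_cospan F W E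
      obtain ⟨r, _⟩ := key i
      exact ⟨j ≫ r⟩
    have huniq (E : CostructuredArrow F d) (a b : E ⟶ W) : a = b := by
      -- `W.hom` extends to the cone of `a - b`, so `q` underlies a map out of `W` and is split mono
      -- by `key`; then `(a - b) ≫ q = 0` gives `a = b`.
      obtain ⟨Z, q, δ, hZ⟩ := distinguished_cocone_triangle (a.left - b.left)
      obtain ⟨z, hz⟩ := exists_map_extension F hZ W.hom (by
        rw [Functor.map_sub, Preadditive.sub_comp, CostructuredArrow.w, CostructuredArrow.w,
          sub_self])
      let i : W ⟶ CostructuredArrow.mk z := CostructuredArrow.homMk q hz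
      obtain ⟨r, hr⟩ := key i
      have hr' : q ≫ r.left = 𝟙 _ := congrArg CommaMorphism.left hr
      have hq : (a.left - b.left) ≫ q = 0 := comp_distTriang_mor_zero₁₂ _ hZ
      refine CostructuredArrow.hom_ext _ _ (sub_eq_zero.1 ?_)
      rw [← Category.comp_id (a.left - b.left), ← hr', reassoc_of% hq, zero_comp]
    exact (IsTerminal.ofUniqueHom (fun E => (hex E).some)
      (fun E m => huniq E m _)).hasTerminal
  exact isLeftAdjoint_of_costructuredArrowTerminals F

end Brown

/-! ### Rigid objects and exact pairings -/

section Rigid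

variable {C : Type u} [Category.{v} C] [MonoidalCategory C]

/-- One triangle identity for `c` and `e` implies the other one after pairing with `x`. -/
theorem whiskerLeft_triangle_comp_evaluation {d x : C} (c : 𝟙_ C ⟶ d ⊗ x) (e : x ⊗ d ⟶ 𝟙_ C)
    (h : x ◁ c ≫ (α_ x d x).inv ≫ e ▷ x = (ρ_ x).hom ≫ (λ_ x).inv) :
    x ◁ ((c ▷ d ≫ (α_ d x d).hom ≫ d ◁ e) ≫ (ρ_ d).hom) ≫ e =
      x ◁ (((λ_ d).hom ≫ (ρ_ d).inv) ≫ (ρ_ d).hom) ≫ e := by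
  have h' : x ◁ c ⊗≫ e ▷ x = ⊗𝟙.hom := by
    convert! h using 1 <;> simp [monoidalComp]
  calc
    _ = 𝟙 _ ⊗≫ x ◁ c ▷ d ⊗≫ ((x ⊗ d) ◁ e ≫ e ▷ (𝟙_ C)) ⊗≫ 𝟙 _ := by
      monoidal
    _ = 𝟙 _ ⊗≫ (x ◁ c ⊗≫ e ▷ x) ▷ d ⊗≫ e := by
      -- The two evaluations act on disjoint factors; interchanging them exposes the known triangle
      -- identity.
      rw [whisker_exchange]
      monoidal
    _ = _ := by
      rw [h']
      monoidal

variable [MonoidalClosed C]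

theorem uncurry_dualTensorHom (x y : C) :
    MonoidalClosed.uncurry (dualTensorHom x y) =
      (α_ x ((ihom x).obj (𝟙_ C)) y).inv ≫ (ihom.ev x).app (𝟙_ C) ▷ y ≫ (λ_ y).hom :=
  MonoidalClosed.uncurry_curry _

/-- A rigid object `x` is paired with its dual `[x, 𝟙]`. -/
abbrev IsRigidObject.exactPairing {x : C} (hx : IsRigidObject x) :
    ExactPairing ((ihom x).obj (𝟙_ C)) x :=
  have := hx x
  -- The coevaluation is the preimage of the identity of `x` under `[x, 𝟙] ⊗ x ≅ [x, x]`, and this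
  -- triangle identity is its uncurried definition.
  have h : x ◁ (MonoidalClosed.curry (ρ_ x).hom ≫ inv (dualTensorHom x x)) ≫
      (α_ x ((ihom x).obj (𝟙_ C)) x).inv ≫ (ihom.ev x).app (𝟙_ C) ▷ x =
        (ρ_ x).hom ≫ (λ_ x).inv := by
    rw [← cancel_mono (λ_ x).hom, Category.assoc, Category.assoc, Category.assoc,
      ← uncurry_dualTensorHom, ← MonoidalClosed.uncurry_natural_left, Category.assoc,
      IsIso.inv_hom_id, Category.comp_id, MonoidalClosed.uncurry_curry, Iso.inv_hom_id,
      Category.comp_id]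
  { coevaluation' := MonoidalClosed.curry (ρ_ x).hom ≫ inv (dualTensorHom x x)
    evaluation' := (ihom.ev x).app (𝟙_ C)
    coevaluation_evaluation' := h
    evaluation_coevaluation' := by
      generalize MonoidalClosed.curry (ρ_ x).hom ≫ inv (dualTensorHom x x) = c at h
      rw [← cancel_mono (ρ_ _).hom]
      apply MonoidalClosed.uncurry_injective
      rw [MonoidalClosed.uncurry_eq, MonoidalClosed.uncurry_eq]
      exact whiskerLeft_triangle_comp_evaluation c _ h }

/-- The map `d ⊗ y ⟶ [x, y]` induced by a pairing of `x` with `d` is an isomorphism. -/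
theorem isIso_curry_evaluation (d x y : C) [ExactPairing d x] :
    IsIso (MonoidalClosed.curry ((α_ x d y).inv ≫ ε_ d x ▷ y ≫ (λ_ y).hom)) := by
  rw [isIso_iff_yoneda_map_bijective]
  intro Z
  have : (fun f : Z ⟶ d ⊗ y =>
      f ≫ MonoidalClosed.curry ((α_ x d y).inv ≫ ε_ d x ▷ y ≫ (λ_ y).hom)) =
      ((tensorLeftHomEquiv Z d x y).symm.trans ((ihom.adjunction x).homEquiv Z y)) := by
    funext f
    exact (MonoidalClosed.curry_natural_left _ _).symm
  rw [this]
  exact Equiv.bijective _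

/-- Duals are unique: the pairing identifies `d` with `[x, 𝟙]`, and under this identification
`dualTensorHom` becomes the isomorphism `d ⊗ y ≅ [x, y]`. -/
theorem isRigidObject_of_exactPairing (d x : C) [ExactPairing d x] : IsRigidObject x := by
  intro y
  have h1 := isIso_curry_evaluation d x (𝟙_ C)
  have h2 := isIso_curry_evaluation d x y
  let i : d ⟶ (ihom x).obj (𝟙_ C) := MonoidalClosed.curry (ε_ d x)
  have hi : i = (ρ_ d).inv ≫
      MonoidalClosed.curry ((α_ x d (𝟙_ C)).inv ≫ ε_ d x ▷ (𝟙_ C) ≫ (λ_ (𝟙_ C)).hom) := by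
    rw [← MonoidalClosed.curry_natural_left]
    refine congrArg MonoidalClosed.curry (?_ : ε_ d x = _)
    rw [unitors_equal, rightUnitor_naturality]
    monoidal
  have : IsIso i := by rw [hi]; infer_instance
  have h3 : i ▷ y ≫ dualTensorHom x y =
      MonoidalClosed.curry ((α_ x d y).inv ≫ ε_ d x ▷ y ≫ (λ_ y).hom) := by
    apply MonoidalClosed.uncurry_injective
    rw [MonoidalClosed.uncurry_natural_left, uncurry_dualTensorHom, MonoidalClosed.uncurry_curry,
      associator_inv_naturality_middle_assoc, ← comp_whiskerRight_assoc,
      ← MonoidalClosed.uncurry_eq, MonoidalClosed.uncurry_curry]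
  rw [← h3] at h2
  exact IsIso.of_isIso_comp_left (i ▷ y) _

end Rigid

/-! ### Strong monoidal functors preserve duals -/

section MapPairing

open Functor.LaxMonoidal Functor.OplaxMonoidal

variable {C : Type u₁} [Category.{v} C] [MonoidalCategory C]
variable {D : Type u₂} [Category.{v} D] [MonoidalCategory D]

/-- The image of an exact pairing under a strong monoidal functor. -/
abbrev mapExactPairing (F : D ⥤ C) [F.Monoidal] (X Y : D) [ExactPairing X Y] :
    ExactPairing (F.obj X) (F.obj Y) where
  coevaluation' := ε F ≫ F.map (η_ X Y) ≫ δ F X Y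
  evaluation' := μ F Y X ≫ F.map (ε_ X Y) ≫ η F
  coevaluation_evaluation' := by
    have h := congrArg F.map (ExactPairing.coevaluation_evaluation X Y)
    simp only [Functor.map_comp, Functor.Monoidal.map_whiskerLeft,
      Functor.Monoidal.map_whiskerRight, Functor.Monoidal.map_associator_inv,
      Functor.Monoidal.map_rightUnitor, Functor.Monoidal.map_leftUnitor_inv, Category.assoc,
      Functor.Monoidal.μ_δ_assoc] at h
    rw [← cancel_epi (δ F Y (𝟙_ D) ≫ F.obj Y ◁ η F), ← cancel_mono (ε F ▷ F.obj Y ≫ μ F (𝟙_ D) Y)]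
    simp only [Category.assoc, comp_whiskerRight, MonoidalCategory.whiskerLeft_comp]
    rw [Functor.Monoidal.whiskerLeft_η_ε_assoc, Functor.Monoidal.whiskerRight_η_ε_assoc, h]
  evaluation_coevaluation' := by
    have h := congrArg F.map (ExactPairing.evaluation_coevaluation X Y)
    simp only [Functor.map_comp, Functor.Monoidal.map_whiskerLeft,
      Functor.Monoidal.map_whiskerRight, Functor.Monoidal.map_associator,
      Functor.Monoidal.map_rightUnitor_inv, Functor.Monoidal.map_leftUnitor, Category.assoc,
      Functor.Monoidal.μ_δ_assoc] at h
    rw [← cancel_epi (δ F (𝟙_ D) X ≫ η F ▷ F.obj X), ← cancel_mono (F.obj X ◁ ε F ≫ μ F X (𝟙_ D))]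
    simp only [Category.assoc, comp_whiskerRight, MonoidalCategory.whiskerLeft_comp]
    rw [Functor.Monoidal.whiskerLeft_η_ε_assoc, Functor.Monoidal.whiskerRight_η_ε_assoc, h]

theorem IsRigidObject.map [MonoidalClosed C] [MonoidalClosed D] (F : D ⥤ C) [F.Monoidal]
    {x : D} (hx : IsRigidObject x) :
    IsRigidObject (F.obj x) :=
  have := hx.exactPairing
  have := mapExactPairing F ((ihom x).obj (𝟙_ D)) x
  isRigidObject_of_exactPairing (F.obj ((ihom x).obj (𝟙_ D))) (F.obj x)

variable {fpull : D ⥤ C} [fpull.Monoidal] {fpush : C ⥤ D}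

theorem tensorLeftHomEquiv_symm_map (d e : D) [ExactPairing d e] {Z W : D} (h : Z ⟶ d ⊗ W) :
    letI := mapExactPairing fpull d e
    (tensorLeftHomEquiv (fpull.obj Z) (fpull.obj d) (fpull.obj e) (fpull.obj W)).symm
      (fpull.map h ≫ δ fpull d W) =
      μ fpull e Z ≫ fpull.map ((tensorLeftHomEquiv Z d e W).symm h) := by
  let := mapExactPairing fpull d e
  change fpull.obj e ◁ _ ≫ (α_ _ _ _).inv ≫ (μ fpull e d ≫ fpull.map (ε_ d e) ≫ η fpull) ▷ _ ≫
    (λ_ _).hom = μ fpull e Z ≫ fpull.map (e ◁ h ≫ (α_ e d W).inv ≫ ε_ d e ▷ W ≫ (λ_ W).hom)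
  simp only [Functor.map_comp, Functor.Monoidal.map_whiskerLeft,
      Functor.Monoidal.map_whiskerRight, Functor.Monoidal.map_associator_inv,
      Functor.Monoidal.map_leftUnitor, Category.assoc,
      Functor.Monoidal.μ_δ_assoc, comp_whiskerRight, MonoidalCategory.whiskerLeft_comp]

end MapPairing

/-! ### The projection formula for rigid objects -/

section ProjectionRigid

variable {C : Type u₁} [Category.{v} C] [MonoidalCategory C]
variable {D : Type u₂} [Category.{v} D] [MonoidalCategory D]

variable {fpull : D ⥤ C} [fpull.Monoidal] {fpush : C ⥤ D} {ftwist : D ⥤ C}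

/-- Maps from `Z` to either side correspond to maps `f^* e ⊗ f^* Z ⟶ y`; by
`tensorLeftHomEquiv_symm_map`, `π` induces the resulting bijection. -/
theorem isIso_projection_of_exactPairing (adj₁ : fpull ⊣ fpush) (y : C) (d e : D)
    [ExactPairing d e] : IsIso ((projection adj₁ y).app d) := by
  let := mapExactPairing fpull d e
  rw [isIso_iff_yoneda_map_bijective]
  intro Z
  let E₁ : (Z ⟶ d ⊗ fpush.obj y) ≃ (fpull.obj e ⊗ fpull.obj Z ⟶ y) :=
    (tensorLeftHomEquiv Z d e (fpush.obj y)).symm.trans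
      ((adj₁.homEquiv _ _).symm.trans (Functor.Monoidal.μIso fpull e Z).symm.homFromEquiv)
  let E₂ : (Z ⟶ fpush.obj (fpull.obj d ⊗ y)) ≃ (fpull.obj e ⊗ fpull.obj Z ⟶ y) :=
    (adj₁.homEquiv _ _).symm.trans
      (tensorLeftHomEquiv (fpull.obj Z) (fpull.obj d) (fpull.obj e) y).symm
  have key : (fun h : Z ⟶ d ⊗ fpush.obj y => h ≫ (projection adj₁ y).app d) =
      E₁.trans E₂.symm := by
    funext h
    rw [Equiv.trans_apply, Equiv.eq_symm_apply]
    change (tensorLeftHomEquiv (fpull.obj Z) (fpull.obj d) (fpull.obj e) y).symm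
      ((adj₁.homEquiv _ _).symm (h ≫ adj₁.homEquiv _ _ _)) =
      Functor.LaxMonoidal.μ fpull e Z ≫ (adj₁.homEquiv _ _).symm
        ((tensorLeftHomEquiv Z d e (fpush.obj y)).symm h)
    rw [Adjunction.homEquiv_naturality_left_symm, Equiv.symm_apply_apply,
      Adjunction.homEquiv_counit, ← Category.assoc]
    refine Eq.trans ((Equiv.symm_apply_eq _).2 ?_) ((congrArg (· ≫ adj₁.counit.app y)
      (tensorLeftHomEquiv_symm_map d e h)).trans (Category.assoc _ _ _))
    rw [tensorLeftHomEquiv_naturality]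
    exact (congrArg (· ≫ _) (Equiv.apply_symm_apply _ _)).symm
  exact key ▸ Equiv.bijective _

variable [SymmetricCategory D] [MonoidalClosed D]

theorem IsRigidObject.isIso_projection (adj₁ : fpull ⊣ fpush) (y : C) {d : D}
    (hd : IsRigidObject d) : IsIso ((projection adj₁ y).app d) :=
  have := hd.exactPairing
  -- The pairing above has `d` on the right; the argument needs it on the left.
  have := BraidedCategory.exactPairing_swap ((ihom d).obj (𝟙_ D)) d
  isIso_projection_of_exactPairing adj₁ y d ((ihom d).obj (𝟙_ D))

variable [SymmetricCategory C] [MonoidalClosed C]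

theorem homEquiv_symm_comp_pushIhom (adj₁ : fpull ⊣ fpush) (adj₂ : fpush ⊣ ftwist) (x : C)
    (κ d : D) (g : d ⟶ (ftwist ⋙ ihom x ⋙ fpush).obj κ) :
    ((tensorRightAdjunction (fpush.obj x)).homEquiv d κ).symm
      (g ≫ (pushIhom adj₁ adj₂ x).app κ) =
      (projection adj₁ x).app d ≫
        (((adj₁.comp (tensorRightAdjunction x)).comp adj₂).homEquiv d κ).symm g := by
  rw [Adjunction.homEquiv_counit, Adjunction.homEquiv_counit, Functor.map_comp, Category.assoc]
  refine (congrArg _ (conjugateEquiv_counit _ _ (projection adj₁ x) κ)).trans ?_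
  exact (projection adj₁ x).naturality_assoc g _

theorem bijective_comp_pushIhom (adj₁ : fpull ⊣ fpush) (adj₂ : fpush ⊣ ftwist) (x : C)
    (κ d : D) (hd : IsRigidObject d) :
    Function.Bijective fun g : d ⟶ (ftwist ⋙ ihom x ⋙ fpush).obj κ =>
      g ≫ (pushIhom adj₁ adj₂ x).app κ := by
  have := hd.isIso_projection adj₁ x
  have key : (fun g : d ⟶ (ftwist ⋙ ihom x ⋙ fpush).obj κ =>
      g ≫ (pushIhom adj₁ adj₂ x).app κ) =
      ((((adj₁.comp (tensorRightAdjunction x)).comp adj₂).homEquiv d κ).symm.trans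
        ((asIso ((projection adj₁ x).app d)).symm.homFromEquiv)).trans
        ((tensorRightAdjunction (fpush.obj x)).homEquiv d κ) := by
    funext g
    exact (Equiv.symm_apply_eq ((tensorRightAdjunction (fpush.obj x)).homEquiv d κ)).1
      (homEquiv_symm_comp_pushIhom adj₁ adj₂ x κ d g)
  exact key ▸ Equiv.bijective _

end ProjectionRigid

/-! ### The direct image and twisted duals -/

section PushIhom

variable {C : Type u₁} [Category.{v} C] [MonoidalCategory C] [SymmetricCategory C]
variable {D : Type u₂} [Category.{v} D] [MonoidalCategory D] [SymmetricCategory D]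

variable {fpull : D ⥤ C} [fpull.Braided] {fpush : C ⥤ D} {ftwist : D ⥤ C}

theorem map_braiding_comp_δ (F : D ⥤ C) [F.Braided] (a b : D) :
    F.map (β_ a b).hom ≫ Functor.OplaxMonoidal.δ F b a =
      Functor.OplaxMonoidal.δ F a b ≫ (β_ (F.obj a) (F.obj b)).hom := by
  rw [← cancel_epi (Functor.LaxMonoidal.μ F a b), Functor.LaxBraided.braided_assoc,
    Functor.Monoidal.μ_δ, Functor.Monoidal.μ_δ_assoc, Category.comp_id]

/-- The lax monoidal structure map `f_* x ⊗ f_* y ⟶ f_* (x ⊗ y)`. -/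
def pushTensor (adj₁ : fpull ⊣ fpush) (x y : C) :
    fpush.obj x ⊗ fpush.obj y ⟶ fpush.obj (x ⊗ y) :=
  letI := adj₁.rightAdjointLaxMonoidal
  Functor.LaxMonoidal.μ fpush x y

theorem pushTensor_eq (adj₁ : fpull ⊣ fpush) (x y : C) :
    pushTensor adj₁ x y = adj₁.homEquiv _ _
      (Functor.OplaxMonoidal.δ fpull _ _ ≫ (adj₁.counit.app x ⊗ₘ adj₁.counit.app y)) :=
  rfl

theorem pushTensor_natural_left (adj₁ : fpull ⊣ fpush) {x x' : C} (f : x ⟶ x') (y : C) :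
    fpush.map f ▷ fpush.obj y ≫ pushTensor adj₁ x' y =
      pushTensor adj₁ x y ≫ fpush.map (f ▷ y) :=
  letI := adj₁.rightAdjointLaxMonoidal
  Functor.LaxMonoidal.μ_natural_left fpush f y

theorem pushTensor_natural_right (adj₁ : fpull ⊣ fpush) (x : C) {y y' : C} (f : y ⟶ y') :
    fpush.obj x ◁ fpush.map f ≫ pushTensor adj₁ x y' =
      pushTensor adj₁ x y ≫ fpush.map (x ◁ f) :=
  letI := adj₁.rightAdjointLaxMonoidal
  Functor.LaxMonoidal.μ_natural_right fpush x f

theorem pushTensor_braiding (adj₁ : fpull ⊣ fpush) (x y : C) :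
    (β_ (fpush.obj x) (fpush.obj y)).hom ≫ pushTensor adj₁ y x =
      pushTensor adj₁ x y ≫ fpush.map (β_ x y).hom := by
  rw [pushTensor_eq, pushTensor_eq, ← Adjunction.homEquiv_naturality_left,
    ← Adjunction.homEquiv_naturality_right]
  refine congrArg _ ?_
  rw [Category.assoc]
  refine Eq.trans ?_ (congrArg (_ ≫ ·)
    (BraidedCategory.braiding_naturality (adj₁.counit.app x) (adj₁.counit.app y)).symm)
  rw [← Category.assoc, ← Category.assoc]
  refine congrArg (· ≫ _) ?_
  exact map_braiding_comp_δ fpull (fpush.obj x) (fpush.obj y)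

/-- This converts the mate of `π` into a formula in the lax monoidal structure of `f_*`. -/
theorem projection_comp_map_counit (adj₁ : fpull ⊣ fpush) (x y : C) :
    (projection adj₁ y).app (fpush.obj x) ≫ fpush.map (adj₁.counit.app x ▷ y) =
      pushTensor adj₁ x y := by
  rw [pushTensor_eq]
  change adj₁.homEquiv _ _ _ ≫ _ = _
  rw [← Adjunction.homEquiv_naturality_right, Category.assoc, ← tensorHom_def']
  rfl

variable [MonoidalClosed C] [MonoidalClosed D]

theorem tensorRightAdjunction_counit_app (x y : C) :
    (tensorRightAdjunction x).counit.app y =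
      (β_ ((ihom x).obj y) x).hom ≫ (ihom.ev x).app y := by
  simp [tensorRightAdjunction, Adjunction.ofNatIsoLeft]
  rw [SymmetricCategory.braiding_swap_eq_inv_braiding]

theorem whiskerRight_pushIhom_braiding_ev (adj₁ : fpull ⊣ fpush) (adj₂ : fpush ⊣ ftwist)
    (κ : D) (x : C) :
    (pushIhom adj₁ adj₂ x).app κ ▷ fpush.obj x ≫
        (β_ ((ihom (fpush.obj x)).obj κ) (fpush.obj x)).hom ≫ (ihom.ev (fpush.obj x)).app κ =
      pushTensor adj₁ ((ihom x).obj (ftwist.obj κ)) x ≫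
        fpush.map ((β_ ((ihom x).obj (ftwist.obj κ)) x).hom ≫
          (ihom.ev x).app (ftwist.obj κ)) ≫ adj₂.counit.app κ := by
  have h := conjugateEquiv_counit ((adj₁.comp (tensorRightAdjunction x)).comp adj₂)
    (tensorRightAdjunction (fpush.obj x)) (projection adj₁ x) κ
  rw [tensorRightAdjunction_counit_app] at h
  refine h.trans ?_
  rw [← tensorRightAdjunction_counit_app, ← projection_comp_map_counit]
  simp

theorem uncurry_pushIhom (adj₁ : fpull ⊣ fpush) (adj₂ : fpush ⊣ ftwist) (κ : D) (x : C) :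
    MonoidalClosed.uncurry ((pushIhom adj₁ adj₂ x).app κ) =
      pushTensor adj₁ x ((ihom x).obj (ftwist.obj κ)) ≫
        fpush.map ((ihom.ev x).app (ftwist.obj κ)) ≫ adj₂.counit.app κ := by
  have h := whiskerRight_pushIhom_braiding_ev adj₁ adj₂ κ x
  rw [BraidedCategory.braiding_naturality_left_assoc, Functor.map_comp, Category.assoc,
    ← reassoc_of% (pushTensor_braiding adj₁ ((ihom x).obj (ftwist.obj κ)) x)] at h
  rw [MonoidalClosed.uncurry_eq]
  exact (cancel_epi _).1 h

/-- The mate construction fixes `x`, so naturality in `x` needs its own argument, by comparing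
adjuncts. -/
theorem pushIhom_natural (adj₁ : fpull ⊣ fpush) (adj₂ : fpush ⊣ ftwist) (κ : D) {x y : C}
    (g : x ⟶ y) :
    fpush.map ((MonoidalClosed.pre g).app (ftwist.obj κ)) ≫ (pushIhom adj₁ adj₂ x).app κ =
      (pushIhom adj₁ adj₂ y).app κ ≫ (MonoidalClosed.pre (fpush.map g)).app κ := by
  apply MonoidalClosed.uncurry_injective
  rw [MonoidalClosed.uncurry_pre_app]
  erw [MonoidalClosed.uncurry_natural_left]
  rw [uncurry_pushIhom, uncurry_pushIhom, reassoc_of% (pushTensor_natural_right adj₁),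
    reassoc_of% (pushTensor_natural_left adj₁), ← Functor.map_comp_assoc, ← Functor.map_comp_assoc,
    MonoidalClosed.id_tensor_pre_app_comp_ev]

/-- With `κ' = f^(1) κ`, both sides are adjunct to `f_* [x, κ'] ⊗ f_* x ⟶ f_* ([x, κ'] ⊗ x) ⟶ f_* κ'
⟶ κ`, the middle map being braiding followed by evaluation. -/
theorem pushIhom_bidualMap (adj₁ : fpull ⊣ fpush) (adj₂ : fpush ⊣ ftwist) (κ : D) (x : C) :
    fpush.map (bidualMap (ftwist.obj κ) x) ≫
        (pushIhom adj₁ adj₂ ((ihom x).obj (ftwist.obj κ))).app κ =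
      bidualMap κ (fpush.obj x) ≫
        (MonoidalClosed.pre ((pushIhom adj₁ adj₂ x).app κ)).app κ := by
  apply MonoidalClosed.uncurry_injective
  rw [MonoidalClosed.uncurry_pre_app]
  erw [MonoidalClosed.uncurry_natural_left]
  rw [uncurry_pushIhom, reassoc_of% (pushTensor_natural_right adj₁), ← Functor.map_comp_assoc,
    bidualMap, bidualMap, MonoidalClosed.uncurry_curry,
    MonoidalClosed.whiskerLeft_curry_ihom_ev_app]
  exact (whiskerRight_pushIhom_braiding_ev adj₁ adj₂ κ x).symm

end PushIhom

/-! ### Coproducts and the direct image -/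

section PreservesCoproducts

open Pretriangulated

variable {C : Type u₁} [Category.{v} C] [Preadditive C]
  {D : Type u₂} [Category.{v} D] [Preadditive D] [HasZeroObject D] [HasShift D ℤ]
  [∀ n : ℤ, (shiftFunctor D n).Additive] [Pretriangulated D]

/-- The right adjoint of a functor that preserves compact objects preserves coproducts. -/
theorem preservesCoproducts_rightAdjoint {F : D ⥤ C} {G : C ⥤ D} (adj : F ⊣ G) [F.Additive]
    [HasCoproducts.{v} C] (hD : IsCompactlyGeneratedCat D)
    (hF : ∀ t : D, IsCompactObject t → IsCompactObject (F.obj t)) (J : Type v) :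
    PreservesColimitsOfShape (Discrete J) G := by
  classical
  have := hD.1
  have : G.Additive := adj.right_adjoint_additive
  obtain ⟨K, T, hT⟩ := hD.exists_isGeneratingFamily
  suffices ∀ X : J → C, PreservesColimit (Discrete.functor X) G from
    preservesColimitsOfShape_of_discrete G
  intro X
  suffices IsIso (sigmaComparison G X) from PreservesCoproduct.of_iso_comparison G X
  have hπ (j : J) : sigmaComparison G X ≫ G.map (Sigma.π X j) =
      Sigma.π (fun j => G.obj (X j)) j := by
    refine Sigma.hom_ext _ _ fun i => ?_
    rw [ι_comp_sigmaComparison_assoc, ← G.map_comp]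
    by_cases h : i = j
    · subst h
      rw [Sigma.ι_π_eq_id, Sigma.ι_π_eq_id, CategoryTheory.Functor.map_id]
    · rw [Sigma.ι_π_of_ne _ h, Sigma.ι_π_of_ne _ h, G.map_zero]
  refine hT.isIso _ (fun k g hg => ?_) fun k g => ?_
  · refine (hT.compact k).eq_zero_of_coordinates _ (fun j => Sigma.π _ j)
      (fun j => Sigma.ι_π_eq_id _ j) (fun i j h => Sigma.ι_π_of_ne _ h) g fun j => ?_
    rw [← hπ j, reassoc_of% hg, zero_comp]
  -- Surjectivity is checked on adjuncts: `F (T k)` is compact, so it suffices to lift maps that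
  -- factor through one summand.
  · let S : AddSubgroup (F.obj (T k) ⟶ ∐ X) :=
      { carrier := {f | ∃ g', g' ≫ sigmaComparison G X = adj.homEquiv _ _ f}
        zero_mem' := ⟨0, by rw [zero_comp, Adjunction.homEquiv_unit, G.map_zero, comp_zero]⟩
        add_mem' := by
          rintro a b ⟨a', ha⟩ ⟨b', hb⟩
          exact ⟨a' + b', by
            rw [Preadditive.add_comp, ha, hb, Adjunction.homEquiv_unit, Adjunction.homEquiv_unit,
              Adjunction.homEquiv_unit, G.map_add, Preadditive.comp_add]⟩
        neg_mem' := by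
          rintro a ⟨a', ha⟩
          exact ⟨-a', by
            rw [Preadditive.neg_comp, ha, Adjunction.homEquiv_unit, Adjunction.homEquiv_unit,
              G.map_neg, Preadditive.comp_neg]⟩ }
    obtain ⟨g', hg'⟩ : (adj.homEquiv _ _).symm g ∈ S :=
      (hF _ (hT.compact k)).mem_of_factors X S (fun j f =>
        ⟨adj.homEquiv _ _ f ≫ Sigma.ι (fun j => G.obj (X j)) j, by
          rw [Category.assoc, ι_comp_sigmaComparison, Adjunction.homEquiv_naturality_right]⟩) _
    exact ⟨g', by rw [hg', Equiv.apply_symm_apply]⟩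

end PreservesCoproducts

section PushIhomIso

variable {C : Type u₁} [Category.{v} C] [MonoidalCategory C] [SymmetricCategory C]
  [MonoidalClosed C]
variable {D : Type u₂} [Category.{v} D] [MonoidalCategory D] [SymmetricCategory D]
  [MonoidalClosed D] [HasZeroObject D] [HasShift D ℤ] [Preadditive D]
  [∀ n : ℤ, (shiftFunctor D n).Additive] [Pretriangulated D] [RigidlyCompactlyGenerated D]

theorem isIso_pushIhom_app {fpull : D ⥤ C} [fpull.Monoidal] {fpush : C ⥤ D} {ftwist : D ⥤ C}
    (adj₁ : fpull ⊣ fpush) (adj₂ : fpush ⊣ ftwist) (x : C) (κ : D) :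
    IsIso ((pushIhom adj₁ adj₂ x).app κ) := by
  obtain ⟨K, T, hT⟩ :=
    (RigidlyCompactlyGenerated.compactlyGenerated (C := D)).exists_isGeneratingFamily
  have hb (k : K) := bijective_comp_pushIhom adj₁ adj₂ x κ (T k)
    ((RigidlyCompactlyGenerated.compact_iff_rigid _).1 (hT.compact k))
  exact hT.isIso _ (fun k g hg => (hb k).1 (hg.trans zero_comp.symm)) fun k g => (hb k).2 g

/-- The natural isomorphism `f_* [-, f^(1) κ] ≅ [f_* -, κ]`. -/
def pushTwistedDualIso {fpull : D ⥤ C} [fpull.Braided] {fpush : C ⥤ D} {ftwist : D ⥤ C}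
    (adj₁ : fpull ⊣ fpush) (adj₂ : fpush ⊣ ftwist) (κ : D) :
    twistedDual (ftwist.obj κ) ⋙ fpush ≅ fpush.op ⋙ twistedDual κ :=
  NatIso.ofComponents
    (fun x =>
      @asIso _ _ _ _ ((pushIhom adj₁ adj₂ x.unop).app κ)
        (isIso_pushIhom_app adj₁ adj₂ x.unop κ))
    (fun g => pushIhom_natural adj₁ adj₂ κ g.unop)

end PushIhomIso

end TensorDuality
end

theorem mainTheorem6
    {C : Type u₁} [Category.{v} C] [MonoidalCategory C] [SymmetricCategory C] [MonoidalClosed C]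
    [HasZeroObject C] [HasShift C ℤ] [Preadditive C] [∀ n : ℤ, (shiftFunctor C n).Additive]
    [Pretriangulated C] [IsTriangulated C] [TensorDuality.TensorTriangulated C]
    [TensorDuality.RigidlyCompactlyGenerated C]
    {D : Type u₂} [Category.{v} D] [MonoidalCategory D] [SymmetricCategory D] [MonoidalClosed D]
    [HasZeroObject D] [HasShift D ℤ] [Preadditive D] [∀ n : ℤ, (shiftFunctor D n).Additive]
    [Pretriangulated D] [IsTriangulated D] [TensorDuality.TensorTriangulated D]
    [TensorDuality.RigidlyCompactlyGenerated D]
    (fpull : D ⥤ C) [fpull.Braided] [fpull.CommShift ℤ] [fpull.IsTriangulated]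
    (hcoprod : ∀ J : Type v, PreservesColimitsOfShape (Discrete J) fpull) :
    (∃ (fpush : C ⥤ D) (ftwist : D ⥤ C), Nonempty (fpull ⊣ fpush) ∧ Nonempty (fpush ⊣ ftwist)) ∧
    ∀ (fpush : C ⥤ D) (ftwist : D ⥤ C) (adj₁ : fpull ⊣ fpush) (adj₂ : fpush ⊣ ftwist) (κ : D),
      ∃ ζ : fpush.op ⋙ (TensorDuality.twistedDuality κ).dual ≅
          (TensorDuality.twistedDuality (ftwist.obj κ)).dual ⋙ fpush,
        (∀ x : C, ζ.inv.app (op x) = (TensorDuality.pushIhom adj₁ adj₂ x).app κ) ∧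
        TensorDuality.IsDualityPreserving (TensorDuality.twistedDuality (ftwist.obj κ))
          (TensorDuality.twistedDuality κ) fpush ζ.inv := by
  refine ⟨?_, fun fpush ftwist adj₁ adj₂ κ =>
    ⟨(TensorDuality.pushTwistedDualIso adj₁ adj₂ κ).symm, fun x => rfl, fun x =>
      TensorDuality.pushIhom_bidualMap adj₁ adj₂ κ x⟩⟩
  have hC := TensorDuality.RigidlyCompactlyGenerated.compactlyGenerated (C := C)
  have hD := TensorDuality.RigidlyCompactlyGenerated.compactlyGenerated (C := D)
  have := hC.1
  have := hD.1
  obtain ⟨fpush, ⟨adj₁⟩⟩ := hD.isLeftAdjoint fpull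
  have := TensorDuality.preservesCoproducts_rightAdjoint adj₁ hD fun t ht =>
    (TensorDuality.RigidlyCompactlyGenerated.compact_iff_rigid _).2
      (((TensorDuality.RigidlyCompactlyGenerated.compact_iff_rigid t).1 ht).map fpull)
  -- `f_*` inherits exactness from its left adjoint, as the second use of Brown representability
  -- requires.
  let := adj₁.rightAdjointCommShift ℤ
  have := adj₁.commShift_of_leftAdjoint ℤ
  have := adj₁.isTriangulated_rightAdjoint
  obtain ⟨ftwist, ⟨adj₂⟩⟩ := hC.isLeftAdjoint fpush
  exact ⟨fpush, ftwist, ⟨adj₁⟩, ⟨adj₂⟩⟩
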